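/- Let $d\ge 1$ be an integer and put $\Delta_d=\mathrm{diag}(1,d)$. Let $\mathbf H_2$ be the Siegel space of symmetric complex $2\times 2$ matrices with positive definite imaginary part. For $\tau\in\mathbf H_2$ let $\Omega_\tau=\begin{pmatrix}\tau\\ \Delta_d\end{pmatrix}$ be the $4\times 2$ period matrix and let $A_{\tau,d}=\mathbf C^2/(\mathbf Z^4\Omega_\tau)$ (vectors are row vectors), a $(1,d)$-polarized abelian surface. Put $$M_3=\begin{pmatrix}-1&0&-1&0\\0&0&0&1\\1&0&0&0\\0&-1&0&-1\end{pmatrix},\qquad M_4=\begin{pmatrix}0&0&-1&0\\0&0&0&1\\1&0&0&0\\0&-1&0&0\end{pmatrix},$$ let $M\ast_d\tau=(A\tau+B\Delta_d)(C\tau+D\Delta_d)^{-1}\Delta_d$ for $M=\begin{pmatrix}A&B\\C&D\end{pmatrix}$, and for $j\in\{3,4\}$ let $$\mathbf H_{j,d}=\{\tau\in\mathbf H_2:\ M_j\ast_d\tau=\tau\}.$$ **Theorem.** Let $j\in\{3,4\}$ and $\tau\in\mathbf H_{j,d}$. Then $A_{\tau,d}$ has an automorphism $\phi_j$ of order $j$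 induced by $M_j$ (that is, $\phi_j$ maps the class of $x\Omega_\tau$ to the class of $xM_j\Omega_\tau$ for all $x\in\mathbf R^4$), and $\mathrm{End}(A_{\tau,d})$ also contains an element $\psi_j$ with $\psi_j^2=d$ such that $$(1+2\phi_3)\psi_3=-\psi_3(1+2\phi_3)\ \text{ if } j=3,\qquad \phi_4\psi_4=-\psi_4\phi_4\ \text{ if } j=4.$$ Moreover, the set $\mathbf H_{j,d}$ is uncountable, and for general $\tau\in\mathbf H_{j,d}$, i.e. for all $\tau$ outside a countable subset of $\mathbf H_{j,d}$ (depending only on $j$ and $d$), the element $\psi_j$ can be taken such that $$\mathrm{End}(A_{\tau,d})=\mathbf Z[\phi_j,\psi_j],$$ and $\mathrm{End}(A_{\tau,d})\otimes_{\mathbf Z}\mathbf Q\cong(-j,d)_{\mathbf Q}$ as $\mathbf Q$-algebras, where $(a,b)_{\mathbf Q}=\mathbf Q\mathbf 1\oplus\mathbf Q\mathbf i\oplus\mathbf Q\mathbf j\oplus\mathbf Q\mathbf i\mathbf j$ is the quaternion algebra with $\mathbf i^2=a$, $\mathbf j^2=b$, $\mathbf i\mathbf j=-\mathbf j\mathbf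 i$. -/

import Mathlib

open scoped Matrix TensorProduct Quaternion

noncomputable section

namespace AbSurf

/-- Index type of the rows of a period matrix; `4 × 4` matrices are written in `2 × 2` blocks. -/
abbrev Idx : Type := Fin 2 ⊕ Fin 2

/-- The Siegel space `𝐇₂` of symmetric complex `2 × 2` matrices with positive definite
imaginary part. -/
def siegel : Set (Matrix (Fin 2) (Fin 2) ℂ) :=
  {τ | τ.IsSymm ∧ (τ.map Complex.im).PosDef}

/-- `Δ_d = diag(1, d)`. -/
def Delta (d : ℕ) : Matrix (Fin 2) (Fin 2) ℂ := !![1, 0; 0, (d : ℂ)]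

/-- The matrix `M_3`. -/
def M3 : Matrix Idx Idx ℤ :=
  Matrix.fromBlocks !![-1, 0; 0, 0] !![-1, 0; 0, 1] !![1, 0; 0, -1] !![0, 0; 0, -1]

/-- The matrix `M_4`. -/
def M4 : Matrix Idx Idx ℤ :=
  Matrix.fromBlocks 0 !![-1, 0; 0, 1] !![1, 0; 0, -1] 0

/-- The matrix `M_j`; it is only used for `j = 3` and `j = 4`. -/
def MM (j : ℕ) : Matrix Idx Idx ℤ := if j = 3 then M3 else M4

/-- The action `M ∗_d τ = (Aτ + BΔ_d)(Cτ + DΔ_d)⁻¹Δ_d`, where `M` has blocks `A, B, C, D`. -/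
def act (d : ℕ) (M : Matrix Idx Idx ℤ) (τ : Matrix (Fin 2) (Fin 2) ℂ) :
    Matrix (Fin 2) (Fin 2) ℂ :=
  (M.toBlocks₁₁.map (Int.cast : ℤ → ℂ) * τ + M.toBlocks₁₂.map (Int.cast : ℤ → ℂ) * Delta d) *
    (M.toBlocks₂₁.map (Int.cast : ℤ → ℂ) * τ +
      M.toBlocks₂₂.map (Int.cast : ℤ → ℂ) * Delta d)⁻¹ * Delta d

/-- `𝐇_{j,d}`: the points of the Siegel space fixed by `M_j`. -/
def fixedLocus (j d : ℕ) : Set (Matrix (Fin 2) (Fin 2) ℂ) :=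
  {τ | τ ∈ siegel ∧ act d (MM j) τ = τ}

/-- The `4 × 2` period matrix with upper block `τ` and lower block `Δ_d`. -/
def period (τ : Matrix (Fin 2) (Fin 2) ℂ) (d : ℕ) : Matrix Idx (Fin 2) ℂ :=
  Matrix.fromRows τ (Delta d)

/-- The point `x Ω` of `ℂ²` with (real) lattice coordinates `x`. -/
def realPoint (τ : Matrix (Fin 2) (Fin 2) ℂ) (d : ℕ) (x : Idx → ℝ) : Fin 2 → ℂ :=
  (fun k => (x k : ℂ)) ᵥ* period τ d

/-- The lattice `Λ = ℤ⁴ Ω ⊆ ℂ²`. -/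
def lattice (τ : Matrix (Fin 2) (Fin 2) ℂ) (d : ℕ) : AddSubgroup (Fin 2 → ℂ) :=
  AddSubgroup.closure (Set.range fun k : Idx => (period τ d) k)

/-- The complex torus `A_{τ,d} = ℂ² / Λ`. -/
abbrev Surf (τ : Matrix (Fin 2) (Fin 2) ℂ) (d : ℕ) : Type :=
  (Fin 2 → ℂ) ⧸ lattice τ d

/-- The projection `ℂ² → A_{τ,d}`. -/
def proj (τ : Matrix (Fin 2) (Fin 2) ℂ) (d : ℕ) : (Fin 2 → ℂ) →+ Surf τ d :=
  QuotientAddGroup.mk' (lattice τ d)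

/-- The endomorphism ring `End(A_{τ,d})`: holomorphic group endomorphisms of `ℂ² / Λ`, with
composition as product. As `ℂ²` is the universal cover, a map `ℂ² / Λ → ℂ² / Λ` is holomorphic
exactly when it lifts to a holomorphic map `ℂ² → ℂ²`. -/
def EndRing (τ : Matrix (Fin 2) (Fin 2) ℂ) (d : ℕ) : Subring (AddMonoid.End (Surf τ d)) where
  carrier := {f | ∃ F : (Fin 2 → ℂ) → (Fin 2 → ℂ), Differentiable ℂ F ∧
    ∀ v, f (proj τ d v) = proj τ d (F v)}
  mul_mem' := by
    rintro f g ⟨F, hF, hf⟩ ⟨G, hG, hg⟩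
    exact ⟨F ∘ G, hF.comp hG, fun v => (congrArg f (hg v)).trans (hf (G v))⟩
  one_mem' := ⟨id, differentiable_id, fun v => rfl⟩
  add_mem' := by
    rintro f g ⟨F, hF, hf⟩ ⟨G, hG, hg⟩
    exact ⟨F + G, hF.add hG, fun v =>
      (congrArg₂ (· + ·) (hf v) (hg v)).trans (map_add (proj τ d) (F v) (G v)).symm⟩
  zero_mem' := ⟨0, differentiable_const _, fun v => by simp⟩
  neg_mem' := by
    rintro f ⟨F, hF, hf⟩
    exact ⟨-F, hF.neg, fun v =>
      (congrArg (- ·) (hf v)).trans (map_neg (proj τ d) (F v)).symm⟩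

/-- `f` is the endomorphism of `A_{τ,d} = ℂ² / ℤ⁴Ω` induced by the integral matrix `M`:
it maps the class of `x Ω` to the class of `x M Ω`, for `x ∈ ℝ⁴` (recall `ℝ⁴Ω = ℂ²`). -/
def IsInducedBy {τ : Matrix (Fin 2) (Fin 2) ℂ} {d : ℕ} (M : Matrix Idx Idx ℤ)
    (f : EndRing τ d) : Prop :=
  ∀ x : Idx → ℝ, (f : AddMonoid.End (Surf τ d)) (proj τ d (realPoint τ d x)) =
    proj τ d (realPoint τ d (x ᵥ* M.map (Int.cast : ℤ → ℝ)))

end AbSurf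

end

/-!
# Endomorphism rings of the abelian surfaces fixed by `M_3` and `M_4`

Both matrices are instances of `rotMat e`, with `e = 1` and `e = 0`, which satisfies
`M² + e M + 1 = 0`. Solving the fixed point equation (`exists_eq_conicMat`, `act_conicMat`) shows
that the fixed locus consists of the `τ = ((a, b), (b, d a))` with `b² = d (a² + e a + 1)`: the part
`Im a > 0` of a conic, which contains a real arc and so is uncountable.

A holomorphic endomorphism of `ℂ² / Λ` lifts to a linear map, and the matrix of the lift defines a
faithful representation `analyticRep` in `M₂(ℂ)`; conversely every pair of an integral `M` and a
complex `T` with `MΩ = ΩTᵀ` gives an endomorphism (`exists_endomorphism`). On the conic this applies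
to `rotMat e` and to `sqrtMat d`, and yields `φ` and `ψ`; their relations
`φ² + e φ + 1 = 0`, `ψ² = d`, `φψ + ψφ = -e ψ` are identities of `2 × 2` matrices.

If `τ` has a transcendental entry then `a` is transcendental, and `1, a, a², b, ab` are linearly
independent over `ℤ` because `X² + e X + 1` is squarefree (`coeffs_eq_zero`). Comparing coefficients
in `MΩ = ΩTᵀ` for an arbitrary endomorphism then shows that `1, φ, ψ, φψ` is a `ℤ`-basis of the
endomorphism ring (`exists_combination`, `combination_eq_zero`). Finally `e + 2φ` and `ψ` anticommute
and have squares `e² - 4 = -j` and `d`, so they are the standard generators of `(-j, d)_ℚ`, and a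
count of dimensions gives the isomorphism (`nonempty_algEquiv_quaternion`).
-/

open scoped Matrix TensorProduct Quaternion

namespace AbSurf

variable {τ : Matrix (Fin 2) (Fin 2) ℂ} {d : ℕ} {e : ℤ} {a b : ℂ}

/-! ### The analytic representation of the endomorphism ring -/

theorem mem_lattice_iff {v : Fin 2 → ℂ} :
    v ∈ lattice τ d ↔ ∃ n : Idx → ℤ, ∑ k, n k • period τ d k = v := by
  rw [lattice, ← Submodule.span_int_eq_addSubgroupClosure, Submodule.mem_toAddSubgroup,
    Submodule.mem_span_range_iff_exists_fun]

theorem countable_lattice : (lattice τ d : Set (Fin 2 → ℂ)).Countable := by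
  refine (Set.countable_range fun n : Idx → ℤ => ∑ k, n k • period τ d k).mono fun v hv => ?_
  exact mem_lattice_iff.1 hv

theorem proj_eq_proj_iff {u v : Fin 2 → ℂ} :
    proj τ d u = proj τ d v ↔ u - v ∈ lattice τ d :=
  QuotientAddGroup.eq_iff_sub_mem

theorem proj_surjective : Function.Surjective (proj τ d) :=
  QuotientAddGroup.mk'_surjective _

/-- A continuous map from a connected space into the lattice is constant, the lattice being
countable. -/
theorem eq_of_continuous_of_mem_lattice {X : Type*} [TopologicalSpace X] [PreconnectedSpace X]
    {F : X → Fin 2 → ℂ} (hF : Continuous F) (h : ∀ x, F x ∈ lattice τ d) (x y : X) :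
    F x = F y :=
  countable_lattice.isTotallyDisconnected (Set.range F) (Set.range_subset_iff.2 h)
    (isPreconnected_range hF) ⟨x, rfl⟩ ⟨y, rfl⟩

/-- The matrix of a linear map `ℂ² → ℂ²` lifting an endomorphism is unique. -/
theorem matrix_eq_of_proj_mulVec_eq {S T : Matrix (Fin 2) (Fin 2) ℂ}
    (h : ∀ v, proj τ d (S *ᵥ v) = proj τ d (T *ᵥ v)) : S = T := by
  refine Matrix.ext_of_mulVec_single fun i => ?_
  have hc : Continuous fun v : Fin 2 → ℂ => S *ᵥ v - T *ᵥ v :=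
    (continuous_const.matrix_mulVec continuous_id).sub
      (continuous_const.matrix_mulVec continuous_id)
  have := eq_of_continuous_of_mem_lattice hc (fun v => proj_eq_proj_iff.1 (h v))
    (Pi.single i 1) 0
  simpa [sub_eq_zero] using this

/-- Every endomorphism of `ℂ² / Λ` lifts to a `ℂ`-linear map: by continuity, the defect of
additivity of a holomorphic lift is a constant lattice vector. -/
theorem exists_matrix_lift (f : EndRing τ d) :
    ∃ T : Matrix (Fin 2) (Fin 2) ℂ,
      ∀ v, (f : AddMonoid.End (Surf τ d)) (proj τ d v) = proj τ d (T *ᵥ v) := by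
  obtain ⟨f, F, hF, hf⟩ := f
  have hadd (u v : Fin 2 → ℂ) : F (u + v) = F u + F v - F 0 := by
    have hc : Continuous fun p : (Fin 2 → ℂ) × (Fin 2 → ℂ) => F (p.1 + p.2) - (F p.1 + F p.2) := by
      have := hF.continuous
      fun_prop
    have := eq_of_continuous_of_mem_lattice (τ := τ) (d := d) hc (fun p => by
      rw [← proj_eq_proj_iff, map_add, ← hf, ← hf, ← hf, map_add, map_add]) (u, v) (0, 0)
    simp only [add_zero] at this
    rw [sub_eq_iff_eq_add] at this
    rw [this]
    abel
  have h0 : proj τ d (F 0) = 0 := by rw [← hf, map_zero, map_zero]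
  let G : (Fin 2 → ℂ) →+ (Fin 2 → ℂ) :=
    { toFun := fun v => F v - F 0
      map_zero' := sub_self _
      map_add' := fun u v => by rw [hadd]; abel }
  have hG : Continuous G := hF.continuous.sub continuous_const
  -- The real-linear map `G` is its own real derivative, which is the complex derivative of `F`.
  have h1 : HasFDerivAt G (G.toRealLinearMap hG) 0 := (G.toRealLinearMap hG).hasFDerivAt
  have h2 : HasFDerivAt G ((fderiv ℂ F 0).restrictScalars ℝ) 0 :=
    ((hF 0).hasFDerivAt.sub_const (F 0)).restrictScalars ℝ
  have h3 (v : Fin 2 → ℂ) : F v - F 0 = fderiv ℂ F 0 v :=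
    DFunLike.congr_fun (h1.unique h2) v
  refine ⟨LinearMap.toMatrix' (fderiv ℂ F 0 : (Fin 2 → ℂ) →ₗ[ℂ] (Fin 2 → ℂ)), fun v => ?_⟩
  rw [LinearMap.toMatrix'_mulVec, ContinuousLinearMap.coe_coe, ← h3, map_sub, h0, sub_zero]
  exact hf v

/-- The matrix, acting on column vectors, of the linear lift of an endomorphism. -/
noncomputable def liftMatrix (f : EndRing τ d) : Matrix (Fin 2) (Fin 2) ℂ :=
  (exists_matrix_lift f).choose

theorem apply_proj (f : EndRing τ d) (v : Fin 2 → ℂ) :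
    (f : AddMonoid.End (Surf τ d)) (proj τ d v) = proj τ d (liftMatrix f *ᵥ v) :=
  (exists_matrix_lift f).choose_spec v

theorem liftMatrix_eq {f : EndRing τ d} {T : Matrix (Fin 2) (Fin 2) ℂ}
    (h : ∀ v, (f : AddMonoid.End (Surf τ d)) (proj τ d v) = proj τ d (T *ᵥ v)) :
    liftMatrix f = T :=
  matrix_eq_of_proj_mulVec_eq fun v => by rw [← apply_proj, h]

/-- The analytic representation `End(A) → M₂(ℂ)`. Matrices act on column vectors, so that it
preserves the order of products. -/
noncomputable def analyticRep (τ : Matrix (Fin 2) (Fin 2) ℂ) (d : ℕ) :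
    EndRing τ d →+* Matrix (Fin 2) (Fin 2) ℂ where
  toFun := liftMatrix
  map_one' := liftMatrix_eq fun v => by simp
  map_mul' f g := liftMatrix_eq fun v => by
    rw [← Matrix.mulVec_mulVec, ← apply_proj, ← apply_proj]
    rfl
  map_zero' := liftMatrix_eq fun v => by simp
  map_add' f g := liftMatrix_eq fun v => by
    rw [Matrix.add_mulVec, map_add, ← apply_proj, ← apply_proj]
    rfl

theorem apply_proj_analyticRep (f : EndRing τ d) (v : Fin 2 → ℂ) :
    (f : AddMonoid.End (Surf τ d)) (proj τ d v) = proj τ d (analyticRep τ d f *ᵥ v) :=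
  apply_proj f v

theorem analyticRep_injective : Function.Injective (analyticRep τ d) := by
  intro f g h
  refine Subtype.ext (AddMonoidHom.ext fun x => ?_)
  obtain ⟨v, rfl⟩ := proj_surjective x
  exact (apply_proj_analyticRep f v).trans (h ▸ (apply_proj_analyticRep g v).symm)

/-- The rational representation: an endomorphism maps the lattice to itself. -/
theorem exists_int_matrix (f : EndRing τ d) :
    ∃ M : Matrix Idx Idx ℤ, M.map (Int.cast : ℤ → ℂ) * period τ d =
      period τ d * (analyticRep τ d f)ᵀ := by
  have h (k : Idx) : ∃ n : Idx → ℤ,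
      ∑ l, n l • period τ d l = analyticRep τ d f *ᵥ period τ d k := by
    rw [← mem_lattice_iff, ← sub_zero (_ *ᵥ _), ← proj_eq_proj_iff, ← apply_proj_analyticRep,
      proj_eq_proj_iff.2 (_ : period τ d k - 0 ∈ lattice τ d), map_zero, map_zero]
    rw [sub_zero]
    exact AddSubgroup.subset_closure ⟨k, rfl⟩
  choose M hM using h
  refine ⟨M, Matrix.ext fun k i => ?_⟩
  have := congrFun (hM k) i
  simp [Matrix.mulVec, dotProduct, Matrix.mul_apply, mul_comm] at this ⊢
  exact this

theorem mulVec_eq_of_mul_period {M : Matrix Idx Idx ℤ} {T : Matrix (Fin 2) (Fin 2) ℂ}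
    (h : M.map (Int.cast : ℤ → ℂ) * period τ d = period τ d * Tᵀ) (x : Idx → ℂ) :
    T *ᵥ (x ᵥ* period τ d) = (x ᵥ* M.map (Int.cast : ℤ → ℂ)) ᵥ* period τ d := by
  rw [Matrix.vecMul_vecMul, h, ← Matrix.vecMul_vecMul, Matrix.vecMul_transpose]

/-- An integral matrix `M` and a complex matrix `T` with `MΩ = ΩTᵀ` define an endomorphism. -/
theorem exists_endomorphism {M : Matrix Idx Idx ℤ} {T : Matrix (Fin 2) (Fin 2) ℂ}
    (h : M.map (Int.cast : ℤ → ℂ) * period τ d = period τ d * Tᵀ) :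
    ∃ f : EndRing τ d, analyticRep τ d f = T ∧ IsInducedBy M f := by
  let L : (Fin 2 → ℂ) →+ (Fin 2 → ℂ) := T.mulVecLin.toAddMonoidHom
  have hL : lattice τ d ≤ (lattice τ d).comap L := by
    intro v hv
    obtain ⟨n, rfl⟩ := mem_lattice_iff.1 hv
    refine mem_lattice_iff.2 ⟨n ᵥ* M, ?_⟩
    have hs (m : Idx → ℤ) :
        ∑ k, m k • period τ d k = (fun k => (m k : ℂ)) ᵥ* period τ d := by
      ext i
      simp [Matrix.vecMul, dotProduct]
    change _ = T *ᵥ _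
    rw [hs, hs, mulVec_eq_of_mul_period h]
    congr 1
    ext k
    simp [Matrix.vecMul, dotProduct]
  let f : EndRing τ d := ⟨QuotientAddGroup.map _ _ L hL, fun v => T *ᵥ v,
    (LinearMap.toContinuousLinearMap T.mulVecLin).differentiable, fun v => rfl⟩
  have hf (v : Fin 2 → ℂ) :
      (f : AddMonoid.End (Surf τ d)) (proj τ d v) = proj τ d (T *ᵥ v) := rfl
  refine ⟨f, liftMatrix_eq hf, fun x => ?_⟩
  rw [hf, realPoint, mulVec_eq_of_mul_period h, realPoint]
  congr 2
  ext k
  simp [Matrix.vecMul, dotProduct]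

/-! ### The fixed locus as a conic -/

/-- A common form of `M_3` (for `e = 1`) and `M_4` (for `e = 0`); it satisfies
`M² + e M + 1 = 0`. -/
def rotMat (e : ℤ) : Matrix Idx Idx ℤ :=
  Matrix.fromBlocks !![-e, 0; 0, 0] !![-1, 0; 0, 1] !![1, 0; 0, -1] !![0, 0; 0, -e]

theorem MM_three : MM 3 = rotMat 1 := by
  simp [MM, M3, rotMat]

theorem MM_four : MM 4 = rotMat 0 := by
  have h : !![(0 : ℤ), 0; 0, 0] = 0 := by ext i k; fin_cases i <;> fin_cases k <;> rfl
  simp [MM, M4, rotMat, h]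

/-- The symmetric matrix `((a, b), (b, d a))`. It is fixed by `rotMat e` when
`b² = d (a² + e a + 1)`; this condition is kept as a separate hypothesis. -/
def conicMat (d : ℕ) (a b : ℂ) : Matrix (Fin 2) (Fin 2) ℂ := !![a, b; b, d * a]

/-- The action of `rotMat e`, with `Aτ + BΔ_d` and `Cτ + DΔ_d` written out. -/
theorem act_rotMat (d : ℕ) (e : ℤ) (a b c : ℂ) :
    act d (rotMat e) !![a, b; b, c] =
      !![-e * a - 1, -e * b; 0, (d : ℂ)] * !![a, b; -b, -c - e * d]⁻¹ * Delta d := by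
  have h1 : (rotMat e).toBlocks₁₁.map (Int.cast : ℤ → ℂ) * !![a, b; b, c] +
      (rotMat e).toBlocks₁₂.map (Int.cast : ℤ → ℂ) * Delta d =
      !![-e * a - 1, -e * b; 0, (d : ℂ)] := by
    ext i k
    fin_cases i <;> fin_cases k <;> simp [rotMat, Delta, Matrix.mul_apply, sub_eq_add_neg]
  have h2 : (rotMat e).toBlocks₂₁.map (Int.cast : ℤ → ℂ) * !![a, b; b, c] +
      (rotMat e).toBlocks₂₂.map (Int.cast : ℤ → ℂ) * Delta d =
      !![a, b; -b, -c - e * d] := by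
    ext i k
    fin_cases i <;> fin_cases k <;> simp [rotMat, Delta, Matrix.mul_apply, sub_eq_add_neg]
  rw [act, h1, h2]

theorem exists_eq_conicMat (hd : 0 < d) (hτ : τ ∈ siegel)
    (h : act d (rotMat e) τ = τ) :
    ∃ a b : ℂ, τ = conicMat d a b ∧ b ^ 2 = d * (a ^ 2 + e * a + 1) ∧ 0 < a.im := by
  obtain ⟨hs, hp⟩ := hτ
  obtain ⟨a, b, c, rfl⟩ : ∃ a b c : ℂ, τ = !![a, b; b, c] :=
    ⟨τ 0 0, τ 0 1, τ 1 1, by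
      ext i k
      fin_cases i <;> fin_cases k <;> simp [hs.apply 0 1]⟩
  have ha : 0 < a.im := by simpa using hp.diag_pos (i := 0)
  have hc : 0 < c.im := by simpa using hp.diag_pos (i := 1)
  have hd' : (d : ℂ) ≠ 0 := by exact_mod_cast hd.ne'
  rw [act_rotMat] at h
  -- If `Cτ + DΔ_d` were singular, its inverse, hence `τ`, would be zero in Lean.
  have hu : IsUnit (!![a, b; -b, -c - e * d] : Matrix (Fin 2) (Fin 2) ℂ).det := by
    by_contra hu
    rw [Matrix.nonsing_inv_apply_not_isUnit _ hu, mul_zero, zero_mul] at h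
    have := congrFun (congrFun h 0) 0
    simp only [Matrix.zero_apply, Matrix.of_apply, Matrix.cons_val', Matrix.cons_val_zero] at this
    simp [← this] at ha
  set X : Matrix (Fin 2) (Fin 2) ℂ := !![-e * a - 1, -e * b; 0, (d : ℂ)]
  set Y : Matrix (Fin 2) (Fin 2) ℂ := !![a, b; -b, -c - e * d]
  obtain ⟨W, hW⟩ : ∃ W, X * Y⁻¹ = W := ⟨_, rfl⟩
  have hX : W * Y = X := by rw [← hW, Matrix.mul_assoc, Matrix.nonsing_inv_mul _ hu, mul_one]
  rw [hW] at h
  have w (i k : Fin 2) := congrFun (congrFun h i) k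
  have x (i k : Fin 2) := congrFun (congrFun hX i) k
  have w1 := w 0 0
  have w2 := w 0 1
  have w3 := w 1 0
  have w4 := w 1 1
  have x1 := x 0 0
  have x4 := x 1 1
  simp [Delta, Matrix.mul_apply, X, Y] at w1 w2 w3 w4 x1 x4
  have key1 : b ^ 2 = d * (a ^ 2 + e * a + 1) := by
    rw [w1] at x1
    linear_combination (-d : ℂ) * x1 - b * w2
  have key2 : c ^ 2 + e * d * c + d ^ 2 = d * b ^ 2 := by
    rw [w3] at x4
    linear_combination (-d : ℂ) * x4 - (c + e * d) * w4
  have hprod : (c - d * a) * (c + d * a + e * d) = 0 := by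
    linear_combination key2 + d * key1
  have hne : c + d * a + e * d ≠ 0 := by
    intro h0
    have := congrArg Complex.im h0
    simp at this
    have : (0 : ℝ) < d * a.im := by positivity
    linarith
  have hca := sub_eq_zero.1 ((mul_eq_zero.1 hprod).resolve_right hne)
  exact ⟨a, b, by rw [conicMat, hca], key1, ha⟩

theorem act_conicMat (hd : 0 < d) (hb : b ^ 2 = d * (a ^ 2 + e * a + 1)) :
    act d (rotMat e) (conicMat d a b) = conicMat d a b := by
  have hd' : (d : ℂ) ≠ 0 := by exact_mod_cast hd.ne'
  have hdet : (!![a, b; -b, -(d * a) - e * d] : Matrix (Fin 2) (Fin 2) ℂ).det = d := by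
    rw [Matrix.det_fin_two_of]
    linear_combination hb
  have hX : (!![-e * a - 1, -e * b; 0, (d : ℂ)] : Matrix (Fin 2) (Fin 2) ℂ) =
      !![a, b / d; b, a] * !![a, b; -b, -(d * a) - e * d] := by
    ext i k
    fin_cases i <;> fin_cases k <;> simp [Matrix.mul_apply] <;> field_simp
    · linear_combination hb
    · ring
    · ring
    · linear_combination -hb
  rw [conicMat, act_rotMat, hX,
    Matrix.mul_nonsing_inv_cancel_right _ _ (by rw [hdet]; exact hd'.isUnit)]
  ext i k
  fin_cases i <;> fin_cases k <;> simp [Delta, Matrix.mul_apply, mul_comm]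
  exact mul_div_cancel₀ b hd'

/-- The arc `a = -e/2 + it`, `0 < t < 1/2`, of the conic. There `a² + e a + 1` is the positive real
number `1 - e²/4 - t²`, so `b` can be taken real. -/
theorem not_countable_fixed (hd : 0 < d) (he : e ^ 2 ≤ 1) :
    ¬ {τ | τ ∈ siegel ∧ act d (rotMat e) τ = τ}.Countable := by
  intro h
  let F (t : ℝ) : Matrix (Fin 2) (Fin 2) ℂ :=
    conicMat d (⟨-e / 2, t⟩ : ℂ) ((√(d * (1 - e ^ 2 / 4 - t ^ 2)) : ℝ) : ℂ)
  have hinj : Function.Injective F := fun s t hst => by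
    have := congrFun (congrFun hst 0) 0
    simpa [F, conicMat] using this
  have hmem : Set.Ioo (0 : ℝ) (1 / 2) ⊆
      F ⁻¹' {τ | τ ∈ siegel ∧ act d (rotMat e) τ = τ} := by
    rintro t ⟨h0, h1⟩
    refine ⟨⟨?_, ?_⟩, act_conicMat hd ?_⟩
    · ext i k
      fin_cases i <;> fin_cases k <;> rfl
    · have : (F t).map Complex.im = Matrix.diagonal ![t, d * t] := by
        ext i k
        fin_cases i <;> fin_cases k <;> simp [F, conicMat]
      rw [this]
      refine Matrix.PosDef.diagonal fun i => ?_
      fin_cases i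
      · simpa using h0
      · simpa using mul_pos (Nat.cast_pos.2 hd) h0
    · have he' : (e : ℝ) ^ 2 ≤ 1 := by exact_mod_cast he
      have hnn : (0 : ℝ) ≤ d * (1 - e ^ 2 / 4 - t ^ 2) := by
        refine mul_nonneg (Nat.cast_nonneg d) ?_
        nlinarith
      rw [← Complex.ofReal_pow, Real.sq_sqrt hnn]
      apply Complex.ext
      · simp [pow_two]
        left
        ring
      · simp [pow_two]
        right
        ring
  exact absurd (Cardinal.Real.Ioo_countable_iff.1 ((h.preimage hinj).mono hmem)) (by norm_num)

/-! ### Linear independence of `1, a, a², b, ab` -/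

theorem quartic_coeffs_eq_zero (ha : Transcendental ℤ a) {c₀ c₁ c₂ c₃ c₄ : ℤ}
    (h : c₀ + c₁ * a + c₂ * a ^ 2 + c₃ * a ^ 3 + c₄ * a ^ 4 = 0) :
    c₀ = 0 ∧ c₁ = 0 ∧ c₂ = 0 ∧ c₃ = 0 ∧ c₄ = 0 := by
  have hP : Polynomial.C c₀ + Polynomial.C c₁ * Polynomial.X + Polynomial.C c₂ * Polynomial.X ^ 2 +
      Polynomial.C c₃ * Polynomial.X ^ 3 + Polynomial.C c₄ * Polynomial.X ^ 4 = 0 :=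
    transcendental_iff.1 ha _ (by simpa using h)
  have hc (n : ℕ) := congrArg (fun P => Polynomial.coeff P n) hP
  simp only [Polynomial.coeff_add, Polynomial.coeff_C_mul, Polynomial.coeff_X_pow,
    Polynomial.coeff_X, Polynomial.coeff_C, Polynomial.coeff_zero] at hc
  exact ⟨by simpa using hc 0, by simpa using hc 1, by simpa using hc 2, by simpa using hc 3,
    by simpa using hc 4⟩

theorem eq_zero_of_sq_eq_sq (he : e = 0 ∨ e = 1) {x y : ℤ} (h1 : x ^ 2 = y ^ 2)
    (h2 : y * (2 * x - e * y) = 0) : x = 0 ∧ y = 0 := by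
  rcases sq_eq_sq_iff_eq_or_eq_neg.1 h1 with rfl | rfl
  · rcases he with rfl | rfl <;> simp at h2 <;> grind
  · rcases he with rfl | rfl <;> simp at h2 <;> grind

/-- If `a` is transcendental then `1, a, a², b, ab` are linearly independent over `ℤ`: a relation
`p(a) = -b q(a)` squares to the polynomial identity `p² = d (X² + e X + 1) q²`, which forces
`X² + e X + 1` to divide first `p` and then `q`. -/
theorem coeffs_eq_zero (hd : 0 < d) (he : e = 0 ∨ e = 1) (ha : Transcendental ℤ a)
    (hb : b ^ 2 = d * (a ^ 2 + e * a + 1)) {p₀ p₁ p₂ q₀ q₁ : ℤ}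
    (h : p₀ + p₁ * a + p₂ * a ^ 2 + b * (q₀ + q₁ * a) = 0) :
    p₀ = 0 ∧ p₁ = 0 ∧ p₂ = 0 ∧ q₀ = 0 ∧ q₁ = 0 := by
  obtain ⟨c0, c1, c2, c3, c4⟩ := quartic_coeffs_eq_zero ha
    (c₀ := p₀ ^ 2 - d * q₀ ^ 2)
    (c₁ := 2 * p₀ * p₁ - d * (2 * q₀ * q₁ + e * q₀ ^ 2))
    (c₂ := p₁ ^ 2 + 2 * p₀ * p₂ - d * (q₀ ^ 2 + 2 * e * q₀ * q₁ + q₁ ^ 2))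
    (c₃ := 2 * p₁ * p₂ - d * (2 * q₀ * q₁ + e * q₁ ^ 2))
    (c₄ := p₂ ^ 2 - d * q₁ ^ 2) (by
      push_cast
      linear_combination (p₀ + p₁ * a + p₂ * a ^ 2 - b * (q₀ + q₁ * a)) * h +
        (q₀ + q₁ * a) ^ 2 * hb)
  have hd' : (d : ℤ) ≠ 0 := by exact_mod_cast hd.ne'
  -- The coordinates of `p²` modulo `X² + e X + 1`, where `p ≡ (p₀ - p₂) + (p₁ - e p₂) X`.
  obtain ⟨hx, hy⟩ : p₀ - p₂ = 0 ∧ p₁ - e * p₂ = 0 := by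
    apply eq_zero_of_sq_eq_sq he
    · rcases he with rfl | rfl
      · linear_combination c0 - c2 + c4
      · linear_combination c0 - c2 + c3
    · rcases he with rfl | rfl
      · linear_combination c1 - c3
      · linear_combination c1 + c4 - c2
  obtain rfl : p₀ = p₂ := sub_eq_zero.1 hx
  obtain rfl : p₁ = e * p₀ := sub_eq_zero.1 hy
  obtain ⟨rfl, rfl⟩ : q₀ = 0 ∧ q₁ = 0 := by
    apply eq_zero_of_sq_eq_sq he
    · refine mul_left_cancel₀ hd' ?_
      linear_combination c4 - c0
    · refine (mul_eq_zero.1 (?_ : (d : ℤ) * _ = 0)).resolve_left hd'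
      rcases he with rfl | rfl
      · linear_combination -c3
      · linear_combination 2 * c4 - c3
  obtain rfl : p₀ = 0 := by simpa using c0
  simp

/-! ### The endomorphisms of the surfaces on the conic -/

/-- The integral matrix of `ψ`, whose square is `d`. -/
def sqrtMat (d : ℕ) : Matrix Idx Idx ℤ :=
  Matrix.fromBlocks !![0, 1; (d : ℤ), 0] 0 0 !![0, 1; (d : ℤ), 0]

/-- The action of `rotMat e` on `ℂ²` (column convention) at the point `(a, b)` of the conic. -/
noncomputable def rotLift (d : ℕ) (e : ℤ) (a b : ℂ) : Matrix (Fin 2) (Fin 2) ℂ :=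
  !![a, -b / d; b, -a - e]

/-- The action of `sqrtMat d` on `ℂ²` (column convention). -/
noncomputable def sqrtLift (d : ℕ) : Matrix (Fin 2) (Fin 2) ℂ := !![0, 1; (d : ℂ), 0]

theorem rotMat_mul_period (hd : 0 < d) (hb : b ^ 2 = d * (a ^ 2 + e * a + 1)) :
    (rotMat e).map (Int.cast : ℤ → ℂ) * period (conicMat d a b) d =
      period (conicMat d a b) d * (rotLift d e a b)ᵀ := by
  have hd' : (d : ℂ) ≠ 0 := by exact_mod_cast hd.ne'
  ext k i
  rcases k with k | k <;> fin_cases k <;> fin_cases i <;>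
    simp [rotMat, period, conicMat, rotLift, Delta, Matrix.mul_apply] <;> field_simp
  all_goals first | ring1 | linear_combination hb | linear_combination -hb

theorem sqrtMat_mul_period :
    (sqrtMat d).map (Int.cast : ℤ → ℂ) * period (conicMat d a b) d =
      period (conicMat d a b) d * (sqrtLift d)ᵀ := by
  ext k i
  rcases k with k | k <;> fin_cases k <;> fin_cases i <;>
    simp [sqrtMat, period, conicMat, sqrtLift, Delta, Matrix.mul_apply]
  all_goals ring

theorem rotLift_sq (hd : 0 < d) (hb : b ^ 2 = d * (a ^ 2 + e * a + 1)) :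
    rotLift d e a b ^ 2 + e * rotLift d e a b + 1 = 0 := by
  have hd' : (d : ℂ) ≠ 0 := by exact_mod_cast hd.ne'
  rw [pow_two, ← zsmul_eq_mul]
  ext i k
  fin_cases i <;> fin_cases k <;> simp [rotLift] <;> field_simp
  all_goals first | linear_combination hb | linear_combination -hb | ring

theorem sqrtLift_sq : sqrtLift d ^ 2 = d := by
  rw [pow_two, ← nsmul_one]
  ext i k
  fin_cases i <;> fin_cases k <;> simp [sqrtLift, Matrix.mul_apply]

theorem rotLift_mul_sqrtLift (hd : 0 < d) :
    rotLift d e a b * sqrtLift d + sqrtLift d * rotLift d e a b + e * sqrtLift d = 0 := by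
  have hd' : (d : ℂ) ≠ 0 := by exact_mod_cast hd.ne'
  rw [← zsmul_eq_mul]
  ext i k
  fin_cases i <;> fin_cases k <;> simp [rotLift, sqrtLift] <;> field_simp
  all_goals ring

theorem combination_apply (hd : 0 < d) (s u t v : ℤ) :
    s • (1 : Matrix (Fin 2) (Fin 2) ℂ) + u • rotLift d e a b + t • sqrtLift d +
      v • (rotLift d e a b * sqrtLift d) =
    !![s + u * a - v * b, -u * (b / d) + t + v * a;
      u * b + t * d - v * (a + e) * d, s - u * (a + e) + v * b] := by
  have hd' : (d : ℂ) ≠ 0 := by exact_mod_cast hd.ne'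
  ext i k
  fin_cases i <;> fin_cases k <;> simp [rotLift, sqrtLift, -zsmul_one, -zsmul_eq_mul] <;>
    simp only [zsmul_eq_mul] <;> field_simp
  all_goals ring

/-- At a generic point, an integral matrix which is `ℂ`-linear on `ℂ²` is an integral combination
of `1`, `rotMat e`, `sqrtMat d` and their product: compare the coefficients of `1, a, a², b, ab`
in `MΩ = ΩTᵀ`. -/
theorem exists_combination (hd : 0 < d) (he : e = 0 ∨ e = 1) (ha : Transcendental ℤ a)
    (hb : b ^ 2 = d * (a ^ 2 + e * a + 1)) {M : Matrix Idx Idx ℤ} {T : Matrix (Fin 2) (Fin 2) ℂ}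
    (h : M.map (Int.cast : ℤ → ℂ) * period (conicMat d a b) d =
      period (conicMat d a b) d * Tᵀ) :
    ∃ s u t v : ℤ, T = s • (1 : Matrix (Fin 2) (Fin 2) ℂ) + u • rotLift d e a b +
      t • sqrtLift d + v • (rotLift d e a b * sqrtLift d) := by
  have hd' : (d : ℂ) ≠ 0 := by exact_mod_cast hd.ne'
  have x (k : Idx) (i : Fin 2) := congrFun (congrFun h k) i
  have x1 := x (.inl 0) 0
  have x2 := x (.inl 0) 1
  have x3 := x (.inl 1) 0
  have x4 := x (.inl 1) 1
  have y1 := x (.inr 0) 0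
  have y2 := x (.inr 0) 1
  have y3 := x (.inr 1) 0
  have y4 := x (.inr 1) 1
  simp [period, conicMat, Delta, Matrix.mul_apply] at x1 x2 x3 x4 y1 y2 y3 y4
  generalize M (.inl 0) (.inl 0) = A₁, M (.inl 0) (.inl 1) = A₂, M (.inl 0) (.inr 0) = B₁,
    M (.inl 0) (.inr 1) = B₂, M (.inr 0) (.inl 0) = C₁, M (.inr 0) (.inl 1) = C₂,
    M (.inr 1) (.inl 0) = C₃, M (.inr 1) (.inl 1) = C₄, M (.inr 0) (.inr 0) = D₁,
    M (.inr 0) (.inr 1) = D₂, M (.inr 1) (.inr 0) = D₃, M (.inr 1) (.inr 1) = D₄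
    at x1 x2 y1 y2 y3 y4
  -- The two equations of the first row of `MΩ = ΩTᵀ`, multiplied by `d`, after elimination of `T`.
  obtain ⟨-, r1, r2, r3, r4⟩ := coeffs_eq_zero hd he ha hb
    (p₀ := d * B₁ - d * C₄) (p₁ := d * A₁ - d * D₁ - d * e * C₄) (p₂ := -d * C₁ - d * C₄)
    (q₀ := d * A₂ - D₃) (q₁ := -d * C₂ - C₃) (by
      push_cast
      linear_combination d * x1 - a * d * y1 - b * y3 + C₄ * hb)
  obtain ⟨-, r5, -, r6, -⟩ := coeffs_eq_zero hd he ha hb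
    (p₀ := d ^ 2 * B₂ - d * C₃) (p₁ := d ^ 2 * A₂ - d ^ 2 * D₂ - d * e * C₃)
    (p₂ := -d ^ 2 * C₂ - d * C₃) (q₀ := d * A₁ - d * D₄) (q₁ := -d * C₁ - d * C₄) (by
      push_cast
      linear_combination d * x2 - a * d * y2 - b * y4 + C₃ * hb)
  have s1 : (C₄ : ℂ) = -C₁ := by
    apply mul_left_cancel₀ hd'
    have := congrArg (Int.cast : ℤ → ℂ) r2
    push_cast at this
    linear_combination -this
  have s2 : (C₃ : ℂ) = -d * C₂ := by
    have := congrArg (Int.cast : ℤ → ℂ) r4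
    push_cast at this
    linear_combination -this
  have s3 : (D₃ : ℂ) = d * A₂ := by
    have := congrArg (Int.cast : ℤ → ℂ) r3
    push_cast at this
    linear_combination -this
  have s4 : (D₄ : ℂ) = D₁ - e * C₁ := by
    apply mul_left_cancel₀ hd'
    have h1 := congrArg (Int.cast : ℤ → ℂ) r1
    have h6 := congrArg (Int.cast : ℤ → ℂ) r6
    push_cast at h1 h6
    linear_combination h1 - h6 + d * e * s1
  have s5 : (D₂ : ℂ) = A₂ + e * C₂ := by
    apply mul_left_cancel₀ (pow_ne_zero 2 hd')
    have := congrArg (Int.cast : ℤ → ℂ) r5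
    push_cast at this
    linear_combination -this - d * e * s2
  refine ⟨D₁, C₁, A₂, -C₂, ?_⟩
  rw [combination_apply hd]
  rw [s1, s2, s3] at y3
  rw [s2, s1, s4] at y4
  rw [s5] at y2
  ext i k
  fin_cases i <;> fin_cases k <;> simp
  · linear_combination -y1
  · apply mul_left_cancel₀ hd'
    field_simp
    linear_combination -y3
  · linear_combination -y2
  · apply mul_left_cancel₀ hd'
    linear_combination -y4

theorem combination_eq_zero (hd : 0 < d) (he : e = 0 ∨ e = 1) (ha : Transcendental ℤ a)
    (hb : b ^ 2 = d * (a ^ 2 + e * a + 1)) {s u t v : ℤ}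
    (h : s • (1 : Matrix (Fin 2) (Fin 2) ℂ) + u • rotLift d e a b + t • sqrtLift d +
      v • (rotLift d e a b * sqrtLift d) = 0) : s = 0 ∧ u = 0 ∧ t = 0 ∧ v = 0 := by
  rw [combination_apply hd] at h
  have h1 := congrFun (congrFun h 0) 0
  have h2 := congrFun (congrFun h 0) 1
  simp at h1 h2
  obtain ⟨rfl, rfl, -, hv, -⟩ := coeffs_eq_zero hd he ha hb
    (p₀ := s) (p₁ := u) (p₂ := 0) (q₀ := -v) (q₁ := 0) (by
      push_cast
      linear_combination h1)
  obtain rfl : v = 0 := neg_eq_zero.1 hv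
  simpa using h2

/-! ### Rings generated by two elements with quaternion relations -/

section Ring

variable {R : Type*} [Ring R] {φ ψ : R}

/-- Elements with `φ² + e φ + 1 = 0`, `ψ² = d`, `φψ + ψφ = -e ψ` give the standard generators
`e + 2φ` and `ψ` of a quaternion algebra over `ℚ`. -/
noncomputable def quaternionBasis (h1 : φ ^ 2 + e * φ + 1 = 0) (h2 : ψ ^ 2 = d)
    (h3 : φ * ψ + ψ * φ + e * ψ = 0) :
    QuaternionAlgebra.Basis (ℚ ⊗[ℤ] R) ((e : ℚ) ^ 2 - 4) 0 (d : ℚ) where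
  i := 1 ⊗ₜ (e + 2 * φ)
  j := 1 ⊗ₜ ψ
  k := 1 ⊗ₜ ((e + 2 * φ) * ψ)
  i_mul_i := by
    have : ((e : R) + 2 * φ) * (e + 2 * φ) = (e ^ 2 - 4 : ℤ) • (1 : R) := by
      have hc : (e : R) * φ = φ * e := Int.cast_comm e φ
      have h1' : φ ^ 2 = -(e * φ) - 1 := by
        rw [eq_sub_iff_add_eq, eq_neg_iff_add_eq_zero, ← h1]
        abel
      calc ((e : R) + 2 * φ) * (e + 2 * φ)
          = e ^ 2 + 2 * (e * φ) + 2 * (φ * e) + 4 * φ ^ 2 := by noncomm_ring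
        _ = (e ^ 2 - 4 : ℤ) • (1 : R) := by
          rw [← hc, h1']
          push_cast [zsmul_eq_mul]
          noncomm_ring
          simp
    rw [Algebra.TensorProduct.tmul_mul_tmul, this, one_mul, TensorProduct.tmul_smul,
      zero_smul, add_zero, ← Algebra.TensorProduct.one_def, ← Int.cast_smul_eq_zsmul ℚ]
    push_cast
    rfl
  j_mul_j := by
    rw [Algebra.TensorProduct.tmul_mul_tmul, ← pow_two ψ, h2, one_mul, ← nsmul_one,
      TensorProduct.tmul_smul, ← Algebra.TensorProduct.one_def, ← Nat.cast_smul_eq_nsmul ℚ]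
  i_mul_j := by rw [Algebra.TensorProduct.tmul_mul_tmul, one_mul]
  j_mul_i := by
    rw [Algebra.TensorProduct.tmul_mul_tmul, one_mul, zero_smul, zero_sub, ← TensorProduct.tmul_neg]
    congr 1
    have hc : (e : R) * ψ = ψ * e := Int.cast_comm e ψ
    have h3' : ψ * φ = -(φ * ψ) - e * ψ := by
      rw [eq_sub_iff_add_eq, eq_neg_iff_add_eq_zero, ← h3]
      abel
    calc ψ * (e + 2 * φ) = ψ * e + 2 * (ψ * φ) := by noncomm_ring
      _ = -((e + 2 * φ) * ψ) := by
        rw [← hc, h3']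
        noncomm_ring

theorem adjoin_eq_top (hspan : ∀ f : R, ∃ s u t v : ℤ,
      f = s • (1 : R) + u • φ + t • ψ + v • (φ * ψ)) :
    Algebra.adjoin ℤ ({φ, ψ} : Set R) = ⊤ := by
  refine eq_top_iff.2 fun f _ => ?_
  obtain ⟨s, u, t, v, rfl⟩ := hspan f
  have hφ : φ ∈ Algebra.adjoin ℤ ({φ, ψ} : Set R) := Algebra.subset_adjoin (by simp)
  have hψ : ψ ∈ Algebra.adjoin ℤ ({φ, ψ} : Set R) := Algebra.subset_adjoin (by simp)
  exact add_mem (add_mem (add_mem (zsmul_mem (one_mem _) s) (zsmul_mem hφ u)) (zsmul_mem hψ t))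
    (zsmul_mem (mul_mem hφ hψ) v)

/-- If moreover `1, φ, ψ, φψ` is a `ℤ`-basis of `R`, then `ℚ ⊗ R` is that quaternion algebra: the
canonical map to `ℚ ⊗ R` is onto and both sides have dimension four. -/
theorem nonempty_algEquiv_quaternion (h1 : φ ^ 2 + e * φ + 1 = 0) (h2 : ψ ^ 2 = d)
    (h3 : φ * ψ + ψ * φ + e * ψ = 0)
    (hspan : ∀ f : R, ∃ s u t v : ℤ, f = s • (1 : R) + u • φ + t • ψ + v • (φ * ψ))
    (hind : ∀ s u t v : ℤ, s • (1 : R) + u • φ + t • ψ + v • (φ * ψ) = 0 →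
      s = 0 ∧ u = 0 ∧ t = 0 ∧ v = 0) :
    Nonempty ((ℚ ⊗[ℤ] R) ≃ₐ[ℚ] QuaternionAlgebra ℚ ((e : ℚ) ^ 2 - 4) 0 (d : ℚ)) := by
  have hli : LinearIndependent ℤ ![1, φ, ψ, φ * ψ] := by
    rw [Fintype.linearIndependent_iff]
    intro g hg
    simp only [Fin.sum_univ_four] at hg
    obtain ⟨h0, h1, h2, h3⟩ := hind _ _ _ _ hg
    intro i
    fin_cases i <;> assumption
  have hsp : ⊤ ≤ Submodule.span ℤ (Set.range ![1, φ, ψ, φ * ψ]) := by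
    intro f _
    obtain ⟨s, u, t, v, rfl⟩ := hspan f
    exact (Submodule.mem_span_range_iff_exists_fun ℤ).2
      ⟨![s, u, t, v], by simp [Fin.sum_univ_four]⟩
  let B := Algebra.TensorProduct.basis ℚ (Module.Basis.mk hli hsp)
  have hfin : Module.Finite ℚ (ℚ ⊗[ℤ] R) := .of_basis B
  have hrank : Module.finrank ℚ (QuaternionAlgebra ℚ ((e : ℚ) ^ 2 - 4) 0 (d : ℚ)) =
      Module.finrank ℚ (ℚ ⊗[ℤ] R) := by
    rw [QuaternionAlgebra.finrank_eq_four, Module.finrank_eq_card_basis B, Fintype.card_fin]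
  let F := (quaternionBasis h1 h2 h3).liftHom
  have hψ : (1 : ℚ) ⊗ₜ[ℤ] ψ ∈ F.range :=
    ⟨⟨0, 0, 1, 0⟩, by simp [F, QuaternionAlgebra.Basis.lift, quaternionBasis]⟩
  have hi : (1 : ℚ) ⊗ₜ[ℤ] ((e : R) + 2 * φ) ∈ F.range :=
    ⟨⟨0, 1, 0, 0⟩, by simp [F, QuaternionAlgebra.Basis.lift, quaternionBasis]⟩
  have hφ : (1 : ℚ) ⊗ₜ[ℤ] φ ∈ F.range := by
    have h : (1 : ℚ) ⊗ₜ[ℤ] φ = (1 / 2 : ℚ) • ((1 : ℚ) ⊗ₜ[ℤ] ((e : R) + 2 * φ) - (e : ℚ) • 1) := by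
      have h2 : (1 : ℚ) ⊗ₜ[ℤ] ((e : R) + 2 * φ) =
          (e : ℚ) • 1 + (2 : ℚ) • ((1 : ℚ) ⊗ₜ[ℤ] φ) := by
        have : (e : R) + 2 * φ = e • (1 : R) + (2 : ℤ) • φ := by
          simp [zsmul_eq_mul]
        rw [this, TensorProduct.tmul_add, TensorProduct.tmul_smul, TensorProduct.tmul_smul,
          ← Algebra.TensorProduct.one_def, ← Int.cast_smul_eq_zsmul ℚ,
          ← Int.cast_smul_eq_zsmul ℚ]
        rfl
      rw [h2, add_sub_cancel_left, smul_smul]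
      norm_num
    rw [h]
    exact F.range.smul_mem (sub_mem hi (F.range.smul_mem (one_mem _) _)) _
  have hF : Function.Surjective F := by
    rw [← AlgHom.range_eq_top, eq_top_iff]
    intro x _
    induction x using TensorProduct.induction_on with
    | zero => exact zero_mem _
    | add x y hx hy => exact add_mem (hx trivial) (hy trivial)
    | tmul q f =>
      have hq : q ⊗ₜ[ℤ] f = q • ((1 : ℚ) ⊗ₜ[ℤ] f) := by
        rw [TensorProduct.smul_tmul', smul_eq_mul, mul_one]
      have hmul : (1 : ℚ) ⊗ₜ[ℤ] (φ * ψ) ∈ F.range := by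
        have := mul_mem hφ hψ
        rwa [Algebra.TensorProduct.tmul_mul_tmul, one_mul] at this
      rw [hq]
      refine F.range.smul_mem ?_ q
      obtain ⟨s, u, t, v, rfl⟩ := hspan f
      simp only [TensorProduct.tmul_add, TensorProduct.tmul_smul]
      exact add_mem (add_mem (add_mem (zsmul_mem (one_mem _) s) (zsmul_mem hφ u))
        (zsmul_mem hψ t)) (zsmul_mem hmul v)
  have hinj : Function.Injective F :=
    (LinearMap.injective_iff_surjective_of_finrank_eq_finrank (f := F.toLinearMap) hrank).2 hF
  exact ⟨(AlgEquiv.ofBijective F ⟨hinj, hF⟩).symm⟩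

end Ring

/-! ### The exceptional set and the conclusion -/

theorem countable_isAlgebraic :
    {τ : Matrix (Fin 2) (Fin 2) ℂ | ∀ i k, IsAlgebraic ℤ (τ i k)}.Countable := by
  have h1 : (Set.univ.pi fun _ : Fin 2 => {x : ℂ | IsAlgebraic ℤ x}).Countable :=
    Set.countable_univ_pi fun _ => Algebraic.countable ℤ ℂ
  have h2 : (Set.univ.pi fun _ : Fin 2 =>
      Set.univ.pi fun _ : Fin 2 => {x : ℂ | IsAlgebraic ℤ x}).Countable :=
    Set.countable_univ_pi fun _ => h1
  refine Set.Countable.mono (fun τ hτ => ?_) h2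
  exact fun i _ k _ => hτ i k

/-- On the conic `b² = d (a² + e a + 1)`, a point with an algebraic first coordinate has all its
coordinates algebraic. -/
theorem transcendental_of_conicMat (hb : b ^ 2 = d * (a ^ 2 + e * a + 1))
    (hτ : ¬ ∀ i k, IsAlgebraic ℤ (conicMat d a b i k)) : Transcendental ℤ a := by
  intro ha
  have hd : IsAlgebraic ℤ (d : ℂ) := by simpa using isAlgebraic_algebraMap (A := ℂ) (d : ℤ)
  have he : IsAlgebraic ℤ (e : ℂ) := by simpa using isAlgebraic_algebraMap (A := ℂ) (e : ℤ)
  have hb' : IsAlgebraic ℤ b := by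
    refine IsAlgebraic.of_pow two_pos ?_
    rw [hb]
    exact hd.mul (((ha.pow 2).add (he.mul ha)).add isAlgebraic_one)
  refine hτ fun i k => ?_
  fin_cases i <;> fin_cases k
  exacts [ha, hb', hb', hd.mul ha]

theorem neg_one_ne_one : (-1 : EndRing τ d) ≠ 1 := by
  intro h
  have h1 := congrFun (congrFun (congrArg (analyticRep τ d) h) 0) 0
  rw [map_neg, map_one, Matrix.neg_apply, Matrix.one_apply_eq] at h1
  norm_num at h1

/-- The endomorphisms `φ, ψ` at a point of the conic: relations at every point, and generation of
the whole ring at a generic one. -/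
theorem exists_endomorphisms (hd : 0 < d) (he : e = 0 ∨ e = 1)
    (hb : b ^ 2 = d * (a ^ 2 + e * a + 1)) (him : 0 < a.im) :
    ∃ φ ψ : EndRing (conicMat d a b) d,
      IsInducedBy (rotMat e) φ ∧ φ ≠ 1 ∧ φ ^ 2 + e * φ + 1 = 0 ∧ ψ ^ 2 = d ∧
      φ * ψ + ψ * φ + e * ψ = 0 ∧
      (Transcendental ℤ a → Algebra.adjoin ℤ {φ, ψ} = ⊤ ∧
        Nonempty ((ℚ ⊗[ℤ] EndRing (conicMat d a b) d) ≃ₐ[ℚ]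
          QuaternionAlgebra ℚ ((e : ℚ) ^ 2 - 4) 0 (d : ℚ))) := by
  obtain ⟨φ, hφ, hφi⟩ := exists_endomorphism (rotMat_mul_period hd hb)
  obtain ⟨ψ, hψ, -⟩ := exists_endomorphism (sqrtMat_mul_period (d := d) (a := a) (b := b))
  have h1 : φ ^ 2 + e * φ + 1 = 0 := analyticRep_injective (by simp [hφ, rotLift_sq hd hb])
  have h2 : ψ ^ 2 = d := analyticRep_injective (by simp [hψ, sqrtLift_sq])
  have h3 : φ * ψ + ψ * φ + e * ψ = 0 :=
    analyticRep_injective (by simp [hφ, hψ, rotLift_mul_sqrtLift hd])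
  have hne : φ ≠ 1 := by
    intro h
    have h4 := congrFun (congrFun (hφ.symm.trans (congrArg (analyticRep _ d) h)) 0) 0
    rw [map_one] at h4
    have h5 := congrArg Complex.im h4
    simp [rotLift] at h5
    exact him.ne' h5
  refine ⟨φ, ψ, hφi, hne, h1, h2, h3, fun ha => ?_⟩
  have hspan (f : EndRing (conicMat d a b) d) : ∃ s u t v : ℤ,
      f = s • 1 + u • φ + t • ψ + v • (φ * ψ) := by
    obtain ⟨M, hM⟩ := exists_int_matrix f
    obtain ⟨s, u, t, v, h⟩ := exists_combination hd he ha hb hM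
    refine ⟨s, u, t, v, analyticRep_injective ?_⟩
    simp only [map_add, map_zsmul, map_mul, map_one, hφ, hψ, h]
  refine ⟨adjoin_eq_top hspan, nonempty_algEquiv_quaternion h1 h2 h3 hspan fun s u t v h => ?_⟩
  refine combination_eq_zero hd he ha hb ?_
  have := congrArg (analyticRep _ d) h
  simpa only [map_add, map_zsmul, map_mul, map_one, map_zero, hφ, hψ] using this

end AbSurf

theorem theorem1p6 (j : ℕ) (hj : j = 3 ∨ j = 4) (d : ℕ) (hd : 0 < d) :
    ¬ (AbSurf.fixedLocus j d).Countable ∧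
    ∃ Z : Set (Matrix (Fin 2) (Fin 2) ℂ), Z.Countable ∧
      ∀ τ ∈ AbSurf.fixedLocus j d, ∃ φ ψ : AbSurf.EndRing τ d,
        AbSurf.IsInducedBy (AbSurf.MM j) φ ∧
        orderOf φ = j ∧
        ψ ^ 2 = (d : AbSurf.EndRing τ d) ∧
        (j = 3 → (1 + 2 * φ) * ψ = -(ψ * (1 + 2 * φ))) ∧
        (j = 4 → φ * ψ = -(ψ * φ)) ∧
        (τ ∉ Z →
          Algebra.adjoin ℤ ({φ, ψ} : Set (AbSurf.EndRing τ d)) = ⊤ ∧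
          Nonempty ((ℚ ⊗[ℤ] AbSurf.EndRing τ d) ≃ₐ[ℚ]
            QuaternionAlgebra ℚ (-(j : ℚ)) 0 (d : ℚ))) := by
  rcases hj with rfl | rfl
  · refine ⟨?_, _, AbSurf.countable_isAlgebraic, fun τ hτ => ?_⟩
    · rw [AbSurf.fixedLocus, AbSurf.MM_three]
      exact AbSurf.not_countable_fixed hd (by norm_num)
    obtain ⟨hτ, hfix⟩ := hτ
    rw [AbSurf.MM_three] at hfix ⊢
    obtain ⟨a, b, rfl, hb, him⟩ := AbSurf.exists_eq_conicMat hd hτ hfix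
    obtain ⟨φ, ψ, hind, hne, h1, h2, h3, hgen⟩ :=
      AbSurf.exists_endomorphisms hd (Or.inr rfl) hb him
    rw [Int.cast_one, one_mul] at h1 h3
    refine ⟨φ, ψ, hind, orderOf_eq_prime ?_ hne, h2, fun _ => ?_, by simp, fun hZ => ?_⟩
    · rw [← sub_eq_zero, ← mul_zero (φ - 1), ← h1]
      noncomm_ring
    · rw [eq_neg_iff_add_eq_zero]
      calc (1 + 2 * φ) * ψ + ψ * (1 + 2 * φ) = 2 * (φ * ψ + ψ * φ + ψ) := by noncomm_ring
        _ = 0 := by rw [h3, mul_zero]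
    · have hc : ((1 : ℤ) : ℚ) ^ 2 - 4 = -((3 : ℕ) : ℚ) := by norm_num
      exact hc ▸ hgen (AbSurf.transcendental_of_conicMat hb hZ)
  · refine ⟨?_, _, AbSurf.countable_isAlgebraic, fun τ hτ => ?_⟩
    · rw [AbSurf.fixedLocus, AbSurf.MM_four]
      exact AbSurf.not_countable_fixed hd (by norm_num)
    obtain ⟨hτ, hfix⟩ := hτ
    rw [AbSurf.MM_four] at hfix ⊢
    obtain ⟨a, b, rfl, hb, him⟩ := AbSurf.exists_eq_conicMat hd hτ hfix
    obtain ⟨φ, ψ, hind, hne, h1, h2, h3, hgen⟩ :=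
      AbSurf.exists_endomorphisms hd (Or.inl rfl) hb him
    rw [Int.cast_zero, zero_mul, add_zero] at h1 h3
    have hsq : φ ^ 2 = -1 := eq_neg_of_add_eq_zero_left h1
    refine ⟨φ, ψ, hind, ?_, h2, by simp, fun _ => eq_neg_of_add_eq_zero_left h3, fun hZ => ?_⟩
    · refine orderOf_eq_prime_pow (p := 2) (n := 1) ?_ ?_
      · rw [pow_one, hsq]
        exact AbSurf.neg_one_ne_one
      · rw [show 2 ^ (1 + 1) = 2 * 2 from rfl, pow_mul, hsq, neg_one_sq]
    · have hc : ((0 : ℤ) : ℚ) ^ 2 - 4 = -((4 : ℕ) : ℚ) := by norm_num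
      exact hc ▸ hgen (AbSurf.transcendental_of_conicMat hb hZ)
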